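/- Let $(\Omega_{\mathbf r},\mu)$ and $(\Omega_{\mathbf c},\nu)$ be probability spaces. Let $\mu_0,\mu_0'$ be probability measures on $\Omega_{\mathbf r}$ and $\mu_1,\mu_1'$ probability measures on $\Omega_{\mathbf c}$ with (a.e.) positive densities $$\rho_{\mathbf r}=\tfrac{d\mu_0}{d\mu},\quad \rho_{\mathbf r}'=\tfrac{d\mu_0'}{d\mu},\quad \rho_{\mathbf c}=\tfrac{d\mu_1}{d\nu},\quad \rho_{\mathbf c}'=\tfrac{d\mu_1'}{d\nu}.$$ Let $\mathcal R,\mathcal R'$ be probability measures on $\Omega_{\mathbf r}\times\Omega_{\mathbf c}$ with $d\mathcal R=e^{-\kappa}\,d(\mu_0\otimes\mu_1)$ and $d\mathcal R'=e^{-\kappa'}\,d(\mu_0'\otimes\mu_1')$, where $\kappa\in L^\infty(\mu_0\otimes\mu_1)$ and $\kappa'\in L^\infty(\mu_0'\otimes\mu_1')$ are real-valued. Assume that for some $M\ge 0$ $$e^{-M}\le \frac{d(\mu_0\otimes\mu_1)}{d(\mu_0'\otimes\mu_1')}\le e^{M}\qquad \mu\otimes\nu\text{-a.s.}$$ For marginals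 $\mu_0,\mu_1$ and a reference measure $\mathcal R$, the static Schrödinger bridge is $\pi^{\mu_0,\mu_1;\mathcal R}=\operatorname{argmin}_{\mathcal H\in\Pi(\mu_0,\mu_1)}D_{\mathrm{KL}}(\mathcal H\,\|\,\mathcal R)$, where $\Pi(\mu_0,\mu_1)$ is the set of couplings of $\mu_0$ and $\mu_1$. The Hellinger distance is $d_H(P,Q)=\bigl(\int(\sqrt{dP/d\sigma}-\sqrt{dQ/d\sigma})^2\,d\sigma\bigr)^{1/2}$, for any $\sigma$-finite measure $\sigma$ dominating $P$ and $Q$ (the value does not depend on $\sigma$). Then the bridges $\pi^{\mu_0,\mu_1;\mathcal R}$ and $\pi^{\mu_0',\mu_1';\mathcal R'}$ exist and are unique, and $$d_H\bigl(\pi^{\mu_0,\mu_1;\mathcal R},\pi^{\mu_0',\mu_1';\mathcal R'}\bigr)^2\le 8\bigl(\|\kappa\|_\infty+M\bigr)\Bigl(\|\rho_{\mathbf r}-\rho_{\mathbf r}'\|_{L^1(\mu)}+\|\rho_{\mathbf c}-\rho_{\mathbf c}'\|_{L^1(\nu)}\Bigr)+4\exp\Bigl(3\max\bigl\{\|\kappa\|_\infty+M,\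 \|\kappa'\|_\infty\bigr\}\Bigr)\,d_H(\mathcal R,\mathcal R')^2 .$$ -/

import Mathlib

open MeasureTheory

/-- `π` is a coupling of `μ₀` and `μ₁`: its two marginals are `μ₀` and `μ₁`. -/
def IsCoupling {X Y : Type*} [MeasurableSpace X] [MeasurableSpace Y]
    (μ₀ : Measure X) (μ₁ : Measure Y) (π : Measure (X × Y)) : Prop :=
  π.map Prod.fst = μ₀ ∧ π.map Prod.snd = μ₁

/-- `π` is a static Schrödinger bridge with marginals `μ₀`, `μ₁` and reference measure `R`:
it minimizes the Kullback-Leibler divergence to `R` among all couplings of `μ₀` and `μ₁`. -/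
def IsSchrodingerBridge {X Y : Type*} [MeasurableSpace X] [MeasurableSpace Y]
    (μ₀ : Measure X) (μ₁ : Measure Y) (R π : Measure (X × Y)) : Prop :=
  IsCoupling μ₀ μ₁ π ∧
    ∀ H : Measure (X × Y), IsCoupling μ₀ μ₁ H →
      InformationTheory.klDiv π R ≤ InformationTheory.klDiv H R

/-- The integral `∫ (√(dP/dσ) - √(dQ/dσ))² dσ`. -/
noncomputable def hellingerSq {Z : Type*} [MeasurableSpace Z] (σ P Q : Measure Z) : ℝ :=
  ∫ z, (√((P.rnDeriv σ z).toReal) - √((Q.rnDeriv σ z).toReal)) ^ 2 ∂σ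

/-- The Hellinger distance of two finite measures (without a factor `1/2`), computed with the
base measure `P + Q`; `hellingerDist_eq` shows that any other dominating σ-finite base measure
gives the same value. -/
noncomputable def hellingerDist {Z : Type*} [MeasurableSpace Z] (P Q : Measure Z) : ℝ :=
  √(hellingerSq (P + Q) P Q)

theorem hellingerDist_eq {Z : Type*} [MeasurableSpace Z] (σ P Q : Measure Z)
    [SigmaFinite σ] [IsFiniteMeasure P] [IsFiniteMeasure Q] (hP : P ≪ σ) (hQ : Q ≪ σ) :
    hellingerDist P Q = √(hellingerSq σ P Q) := by
  have hS : P + Q ≪ σ := Measure.AbsolutelyContinuous.add_left hP hQ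
  have hP' : P ≪ P + Q := Measure.absolutelyContinuous_of_le (Measure.le_add_right le_rfl)
  have hQ' : Q ≪ P + Q := Measure.absolutelyContinuous_of_le (Measure.le_add_left le_rfl)
  unfold hellingerDist hellingerSq
  congr 1
  rw [← integral_rnDeriv_smul hS]
  refine integral_congr_ae ?_
  filter_upwards [Measure.rnDeriv_mul_rnDeriv (κ := σ) hP',
    Measure.rnDeriv_mul_rnDeriv (κ := σ) hQ'] with z h1 h2
  rw [← h1, ← h2]
  simp only [Pi.mul_apply, ENNReal.toReal_mul, smul_eq_mul]
  rw [Real.sqrt_mul ENNReal.toReal_nonneg, Real.sqrt_mul ENNReal.toReal_nonneg, ← sub_mul,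
    mul_pow, Real.sq_sqrt ENNReal.toReal_nonneg, mul_comm]

/-- The norm `‖f‖_{L^∞(σ)}`: the essential supremum of `|f|`. It is the true norm for every
`f` with `MemLp f ⊤ σ`. -/
noncomputable def linftyNorm {Z : Type*} [MeasurableSpace Z] (σ : Measure Z) (f : Z → ℝ) : ℝ :=
  (eLpNorm f ⊤ σ).toReal

/-! Both bridges are exponential tilts of their reference by a sum f(x) + g(y) of bounded
potentials. They are compared through an intermediate bridge with reference `R` and the primed
marginals.

For tilts P = e^φ R and P' = e^ψ R' with |φ|, |ψ| ≤ B, `hellingerDist_withDensity_exp_sq_le`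
integrates an elementary pointwise inequality to d_H(P, P')² ≤ e^B d_H(R, R')² + ½ (∫(φ-ψ) dP -
∫(φ-ψ) dP'). As φ-ψ splits into a function of x plus a function of y, the bracket depends only on
the marginals. Changing the marginals with `R` fixed leaves only the bracket, at most oscillation
times L¹ distance of the densities. Changing the reference with the marginals fixed makes the
bracket vanish.

Potentials exist because the soft transform strictly contracts oscillation
(`softTransform_contraction`). Their oscillation is at most twice the bound on the cost, and their
sum at most three times it (`exists_schrodinger_potentials`). The resulting tilt is the unique
minimizer by a Pythagorean identity (`isSchrodingerBridge_iff_eq`). -/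

/-- The soft `c`-transform `x ↦ -log ∫ exp (g y - c x y) dm(y)`. -/
noncomputable def softTransform {X Y : Type*} [MeasurableSpace Y] (m : Measure Y)
    (c : X → Y → ℝ) (g : Y → ℝ) (x : X) : ℝ :=
  -Real.log (∫ y, Real.exp (g y - c x y) ∂m)

/-! ### Soft transform: oscillation bound and contraction -/

section SoftTransform

variable {X Y : Type*} [MeasurableSpace X] [MeasurableSpace Y] {m : Measure Y}
  [IsProbabilityMeasure m] {c : X → Y → ℝ} {g g₁ g₂ : Y → ℝ} {K B : ℝ}

theorem integrable_exp_of_abs_le {Z : Type*} [MeasurableSpace Z] {σ : Measure Z}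
    [IsFiniteMeasure σ] {φ : Z → ℝ} (hφ : Measurable φ) (hB : ∀ z, |φ z| ≤ B) :
    Integrable (fun z => Real.exp (φ z)) σ := by
  refine Integrable.of_bound hφ.exp.aestronglyMeasurable (Real.exp B) (ae_of_all _ fun z => ?_)
  rw [Real.norm_eq_abs, abs_of_pos (Real.exp_pos _)]
  exact Real.exp_le_exp.2 (le_of_abs_le (hB z))

theorem integrable_exp_sub (hc : Measurable (Function.uncurry c)) (hK : ∀ x y, |c x y| ≤ K)
    (hg : Measurable g) (hB : ∀ y, |g y| ≤ B) (x : X) :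
    Integrable (fun y => Real.exp (g y - c x y)) m := by
  refine integrable_exp_of_abs_le (B := B + K) (hg.sub (hc.comp measurable_prodMk_left)) fun y => ?_
  have h1 := abs_le.1 (hB y)
  have h2 := abs_le.1 (hK x y)
  exact abs_le.2 ⟨by linarith, by linarith⟩

theorem exp_neg_softTransform (hc : Measurable (Function.uncurry c)) (hK : ∀ x y, |c x y| ≤ K)
    (hg : Measurable g) (hB : ∀ y, |g y| ≤ B) (x : X) :
    Real.exp (-softTransform m c g x) = ∫ y, Real.exp (g y - c x y) ∂m := by
  rw [softTransform, neg_neg, Real.exp_log]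
  exact integral_exp_pos (integrable_exp_sub hc hK hg hB x)

theorem measurable_softTransform (hc : Measurable (Function.uncurry c)) (hg : Measurable g) :
    Measurable (softTransform m c g) := by
  refine (Real.measurable_log.comp ?_).neg
  have h : Measurable (Function.uncurry fun (x : X) (y : Y) => Real.exp (g y - c x y)) :=
    ((hg.comp measurable_snd).sub hc).exp
  exact h.stronglyMeasurable.integral_prod_right.measurable

/-- Moving x changes the exponent by at most 2K for every y, so the bound does not depend on g. All
quantitative bounds on potentials come from here. -/
theorem softTransform_sub_le (hc : Measurable (Function.uncurry c)) (hK : ∀ x y, |c x y| ≤ K)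
    (hg : Measurable g) (hB : ∀ y, |g y| ≤ B) (x x' : X) :
    softTransform m c g x - softTransform m c g x' ≤ 2 * K := by
  have h : Real.exp (-softTransform m c g x') ≤
      Real.exp (2 * K) * Real.exp (-softTransform m c g x) := by
    rw [exp_neg_softTransform hc hK hg hB, exp_neg_softTransform hc hK hg hB,
      ← integral_const_mul]
    refine integral_mono (integrable_exp_sub hc hK hg hB x')
      ((integrable_exp_sub hc hK hg hB x).const_mul _) fun y => ?_
    dsimp only
    rw [← Real.exp_add]
    have h1 := abs_le.1 (hK x y)
    have h2 := abs_le.1 (hK x' y)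
    exact Real.exp_le_exp.2 (by linarith)
  rw [← Real.exp_add, Real.exp_le_exp] at h
  linarith

theorem abs_softTransform_sub_le (hc : Measurable (Function.uncurry c)) (hK : ∀ x y, |c x y| ≤ K)
    (hg : Measurable g) (hB : ∀ y, |g y| ≤ B) (x x' : X) :
    |softTransform m c g x - softTransform m c g x'| ≤ 2 * K :=
  abs_sub_le_iff.2 ⟨softTransform_sub_le hc hK hg hB x x', softTransform_sub_le hc hK hg hB x' x⟩

theorem exists_abs_softTransform_le (hc : Measurable (Function.uncurry c))
    (hK : ∀ x y, |c x y| ≤ K) (hg : Measurable g) (hB : ∀ y, |g y| ≤ B) :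
    ∃ B', ∀ x, |softTransform m c g x| ≤ B' := by
  rcases isEmpty_or_nonempty X with h | ⟨⟨x₀⟩⟩
  · exact ⟨0, fun x => h.elim x⟩
  · refine ⟨2 * K + |softTransform m c g x₀|, fun x => ?_⟩
    have := abs_softTransform_sub_le (m := m) hc hK hg hB x x₀
    linarith [abs_sub_abs_le_abs_sub (softTransform m c g x) (softTransform m c g x₀)]

/-- The soft transform is a strict contraction for the oscillation seminorm. -/
theorem softTransform_contraction (hc : Measurable (Function.uncurry c))
    (hK : ∀ x y, |c x y| ≤ K) (hg₁ : Measurable g₁) (hg₂ : Measurable g₂)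
    (hB₁ : ∀ y, |g₁ y| ≤ B) (hB₂ : ∀ y, |g₂ y| ≤ B) {ω : ℝ}
    (hω : ∀ y y', (g₁ y - g₂ y) - (g₁ y' - g₂ y') ≤ ω) (x x' : X) :
    (softTransform m c g₁ x - softTransform m c g₂ x) -
      (softTransform m c g₁ x' - softTransform m c g₂ x') ≤ (1 - Real.exp (-(4 * K))) * ω := by
  have hne : Nonempty Y := nonempty_of_isProbabilityMeasure m
  -- One factor e^(-2K) comes from the oscillation of the transform, the other from that of the
  -- cost.
  set ε := Real.exp (-(4 * K)) with hε
  have hK0 : 0 ≤ K := (abs_nonneg _).trans (hK x hne.some)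
  have hε0 : 0 < ε := Real.exp_pos _
  have hε1 : ε ≤ 1 := Real.exp_le_one_iff.2 (by linarith)
  have hbdd : BddBelow (Set.range fun y => g₁ y - g₂ y) := by
    refine ⟨g₁ hne.some - g₂ hne.some - ω, ?_⟩
    rintro _ ⟨y, rfl⟩
    have := hω hne.some y
    dsimp only; linarith
  set s := ⨅ y, (g₁ y - g₂ y) with hs
  have hs1 : ∀ y, s ≤ g₁ y - g₂ y := fun y => ciInf_le hbdd y
  have hs2 : ∀ y, g₁ y - g₂ y ≤ s + ω := fun y => by
    have : g₁ y - g₂ y - ω ≤ s := le_ciInf fun y' => by have := hω y y'; linarith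
    linarith
  have e1 := exp_neg_softTransform (m := m) hc hK hg₁ hB₁
  have e2 := exp_neg_softTransform (m := m) hc hK hg₂ hB₂
  have i1 := integrable_exp_sub (m := m) hc hK hg₁ hB₁
  have i2 := integrable_exp_sub (m := m) hc hK hg₂ hB₂
  have osc := softTransform_sub_le (m := m) hc hK hg₂ hB₂
  set a₁ := softTransform m c g₁ x
  set a₂ := softTransform m c g₂ x
  set b₁ := softTransform m c g₁ x'
  set b₂ := softTransform m c g₂ x'
  -- the Gibbs measure at `x` dominates `ε` times the Gibbs measure at `x'`
  have key : ε * Real.exp (b₂ - b₁) + (1 - ε) * Real.exp s ≤ Real.exp (a₂ - a₁) := by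
    have h0 : 0 ≤ ∫ y, (Real.exp a₂ * (Real.exp (g₁ y - c x y) - Real.exp s * Real.exp (g₂ y - c x y))
        - ε * Real.exp b₂ * (Real.exp (g₁ y - c x' y) -
          Real.exp s * Real.exp (g₂ y - c x' y))) ∂m := by
      refine integral_nonneg fun y => ?_
      have f1 : ∀ t, Real.exp (g₁ y - t) = Real.exp (g₁ y - g₂ y) * Real.exp (g₂ y - t) := by
        intro t; rw [← Real.exp_add]; ring_nf
      have f2 : Real.exp s ≤ Real.exp (g₁ y - g₂ y) := Real.exp_le_exp.2 (hs1 y)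
      have f3 : ε * Real.exp b₂ * Real.exp (g₂ y - c x' y) ≤
          Real.exp a₂ * Real.exp (g₂ y - c x y) := by
        rw [hε, ← Real.exp_add, ← Real.exp_add, ← Real.exp_add, Real.exp_le_exp]
        have h1 := abs_le.1 (hK x y)
        have h2 := abs_le.1 (hK x' y)
        have h3 := osc x' x
        linarith
      dsimp only [Pi.zero_apply]
      rw [f1 (c x y), f1 (c x' y)]
      nlinarith [mul_nonneg (sub_nonneg.2 f2) (sub_nonneg.2 f3)]
    have j : ∀ z, Integrable
        (fun y => Real.exp (g₁ y - c z y) - Real.exp s * Real.exp (g₂ y - c z y)) m :=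
      fun z => (i1 z).sub ((i2 z).const_mul _)
    rw [integral_sub ((j x).const_mul _) ((j x').const_mul _), integral_const_mul, integral_const_mul,
      integral_sub (i1 x) ((i2 x).const_mul _), integral_sub (i1 x') ((i2 x').const_mul _),
      integral_const_mul, integral_const_mul, ← e1, ← e2, ← e1, ← e2] at h0
    have r1 : Real.exp (a₂ - a₁) = Real.exp a₂ * Real.exp (-a₁) := by
      rw [← Real.exp_add]; ring_nf
    have r2 : Real.exp (b₂ - b₁) = Real.exp b₂ * Real.exp (-b₁) := by
      rw [← Real.exp_add]; ring_nf
    have r3 : Real.exp a₂ * Real.exp (-a₂) = 1 := by rw [← Real.exp_add]; simp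
    have r4 : Real.exp b₂ * Real.exp (-b₂) = 1 := by rw [← Real.exp_add]; simp
    rw [r1, r2]
    linear_combination h0 - Real.exp s * r3 + ε * Real.exp s * r4
  -- Jensen for exp turns the mixture bound into one on the exponents.
  have conv : ε * (b₂ - b₁) + (1 - ε) * s ≤ a₂ - a₁ := by
    rw [← Real.exp_le_exp]
    refine le_trans ?_ key
    simpa using convexOn_exp.2 (Set.mem_univ (b₂ - b₁)) (Set.mem_univ s) hε0.le
      (sub_nonneg.2 hε1) (by ring)
  have top : b₂ - b₁ ≤ s + ω := by
    have : Real.exp (-b₁) ≤ Real.exp (s + ω) * Real.exp (-b₂) := by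
      rw [e1, e2, ← integral_const_mul]
      refine integral_mono (i1 x') ((i2 x').const_mul _) fun y => ?_
      dsimp only
      rw [← Real.exp_add]
      exact Real.exp_le_exp.2 (by linarith [hs2 y])
    rw [← Real.exp_add, Real.exp_le_exp] at this
    linarith
  nlinarith [mul_le_mul_of_nonneg_left top (sub_nonneg.2 hε1)]

end SoftTransform

/-! ### Existence of potentials by iterating the soft transforms -/

/-- A bounded measurable cost admits bounded Schrödinger potentials. -/
theorem exists_softTransform_eq {X Y : Type*} [MeasurableSpace X] [MeasurableSpace Y]
    (μ₀ : Measure X) (μ₁ : Measure Y) [IsProbabilityMeasure μ₀] [IsProbabilityMeasure μ₁]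
    {c : X → Y → ℝ} {K : ℝ} (hc : Measurable (Function.uncurry c)) (hK : ∀ x y, |c x y| ≤ K) :
    ∃ (f : X → ℝ) (g : Y → ℝ) (B : ℝ), Measurable f ∧ Measurable g ∧ (∀ x, |f x| ≤ B) ∧
      (∀ y, |g y| ≤ B) ∧ f = softTransform μ₁ c g ∧ g = softTransform μ₀ (flip c) f := by
  obtain ⟨x₀⟩ : Nonempty X := nonempty_of_isProbabilityMeasure μ₀
  obtain ⟨y₀⟩ : Nonempty Y := nonempty_of_isProbabilityMeasure μ₁
  have hK0 : 0 ≤ K := (abs_nonneg _).trans (hK x₀ y₀)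
  have hc' : Measurable (Function.uncurry (flip c)) := hc.comp measurable_swap
  have hK' : ∀ y x, |flip c y x| ≤ K := fun y x => hK x y
  let S : (Y → ℝ) → Y → ℝ := fun g => softTransform μ₀ (flip c) (softTransform μ₁ c g)
  -- Potentials are determined only up to a constant. Pinning the value at `y₀` to zero turns
  -- oscillation bounds into sup bounds.
  let Φ : (Y → ℝ) → Y → ℝ := fun g y => S g y - S g y₀
  let P : (Y → ℝ) → Prop := fun g => Measurable g ∧ ∀ y, |g y| ≤ 2 * K
  have hΦ : ∀ g, P g → P (Φ g) := by
    rintro g ⟨hg, hB⟩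
    obtain ⟨B', hB'⟩ := exists_abs_softTransform_le (m := μ₁) hc hK hg hB
    have hm := measurable_softTransform (m := μ₁) hc hg
    exact ⟨(measurable_softTransform hc' hm).sub_const _,
      fun y => abs_softTransform_sub_le hc' hK' hm hB' y y₀⟩
  set r := (1 - Real.exp (-(4 * K))) * (1 - Real.exp (-(4 * K))) with hr
  have he0 := Real.exp_pos (-(4 * K))
  have he1 : Real.exp (-(4 * K)) ≤ 1 := Real.exp_le_one_iff.2 (by linarith)
  have hr0 : 0 ≤ r := mul_self_nonneg _
  have hr1 : r < 1 := by rw [hr]; nlinarith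
  have hcon : ∀ g₁ g₂, P g₁ → P g₂ → ∀ ω, (∀ y y', (g₁ y - g₂ y) - (g₁ y' - g₂ y') ≤ ω) →
      ∀ y y', (Φ g₁ y - Φ g₂ y) - (Φ g₁ y' - Φ g₂ y') ≤ r * ω := by
    rintro g₁ g₂ ⟨hg₁, hB₁⟩ ⟨hg₂, hB₂⟩ ω hω y y'
    obtain ⟨B₁, hB₁'⟩ := exists_abs_softTransform_le (m := μ₁) hc hK hg₁ hB₁
    obtain ⟨B₂, hB₂'⟩ := exists_abs_softTransform_le (m := μ₁) hc hK hg₂ hB₂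
    have := softTransform_contraction (m := μ₀) (B := max B₁ B₂) hc' hK'
      (measurable_softTransform (m := μ₁) hc hg₁) (measurable_softTransform (m := μ₁) hc hg₂)
      (fun x => (hB₁' x).trans (le_max_left _ _)) (fun x => (hB₂' x).trans (le_max_right _ _))
      (softTransform_contraction (m := μ₁) hc hK hg₁ hg₂ hB₁ hB₂ hω) y y'
    simp only [Φ, S, hr]
    linarith
  let u : ℕ → Y → ℝ := fun n => Φ^[n] 0
  have hu_succ : ∀ n, u (n + 1) = Φ (u n) := fun n => Function.iterate_succ_apply' _ _ _
  have hu : ∀ n, P (u n) := by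
    intro n
    induction n with
    | zero => exact ⟨measurable_const, fun y => by simp [u, hK0]⟩
    | succ n ih => rw [hu_succ]; exact hΦ _ ih
  have hu0 : ∀ n, u n y₀ = 0 := by
    intro n
    cases n with
    | zero => rfl
    | succ n => rw [hu_succ]; simp [Φ]
  -- The constant 8K bounds four values of size at most 2K in the base case.
  have hosc : ∀ n y y', (u (n + 1) y - u n y) - (u (n + 1) y' - u n y') ≤ (8 * K) * r ^ n := by
    intro n
    induction n with
    | zero =>
      intro y y'
      have h1 := abs_le.1 ((hu 1).2 y)
      have h2 := abs_le.1 ((hu 1).2 y')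
      have h3 := abs_le.1 ((hu 0).2 y)
      have h4 := abs_le.1 ((hu 0).2 y')
      simp only [zero_add, pow_zero]
      linarith
    | succ n ih =>
      intro y y'
      have := hcon _ _ (hu (n + 1)) (hu n) _ ih y y'
      rw [← hu_succ, ← hu_succ] at this
      rw [pow_succ]
      linarith
  have hdist : ∀ y n, dist (u n y) (u (n + 1) y) ≤ (8 * K) * r ^ n := by
    intro y n
    have h1 := hosc n y y₀
    have h2 := hosc n y₀ y
    rw [hu0, hu0] at h1 h2
    rw [Real.dist_eq, abs_le]
    constructor <;> linarith
  choose g hg using fun y => cauchySeq_tendsto_of_complete (cauchySeq_of_le_geometric r _ hr1 (hdist y))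
  have hdg : ∀ n y, |u n y - g y| ≤ (8 * K) * r ^ n / (1 - r) := fun n y =>
    dist_le_of_le_geometric_of_tendsto r _ hr1 (hdist y) (hg y) n
  have hPg : P g :=
    ⟨measurable_of_tendsto_metrizable (fun n => (hu n).1) (tendsto_pi_nhds.2 hg),
      fun y => le_of_tendsto (hg y).abs (Filter.Eventually.of_forall fun n => (hu n).2 y)⟩
  have hfix : ∀ y, Φ g y = g y := by
    intro y
    have hb : ∀ n, |u (n + 1) y - Φ g y| ≤ r * (2 * ((8 * K) * r ^ n / (1 - r))) := by
      intro n
      have hω : ∀ (a b : Y → ℝ), (∀ y, |a y - b y| ≤ (8 * K) * r ^ n / (1 - r)) →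
          ∀ y y', (a y - b y) - (a y' - b y') ≤ 2 * ((8 * K) * r ^ n / (1 - r)) := by
        intro a b h y y'
        have h1 := abs_le.1 (h y)
        have h2 := abs_le.1 (h y')
        linarith
      have h1 := hcon _ _ (hu n) hPg _ (hω _ _ (hdg n)) y y₀
      have h2 := hcon _ _ (hu n) hPg _ (hω _ _ (hdg n)) y₀ y
      have h3 : Φ (u n) y₀ = 0 := by simp [Φ]
      have h4 : Φ g y₀ = 0 := by simp [Φ]
      rw [h3, h4] at h1 h2
      rw [hu_succ, abs_le]
      constructor <;> linarith
    have hlim : Filter.Tendsto (fun n : ℕ => r * (2 * ((8 * K) * r ^ n / (1 - r)))) Filter.atTop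
        (nhds 0) := by
      have := ((((tendsto_pow_atTop_nhds_zero_of_lt_one hr0 hr1).const_mul (8 * K)).div_const
        (1 - r)).const_mul 2).const_mul r
      simpa using this
    have h1 : Filter.Tendsto (fun n => u (n + 1) y) Filter.atTop (nhds (Φ g y)) := by
      rw [tendsto_iff_dist_tendsto_zero]
      exact squeeze_zero (fun n => dist_nonneg) hb hlim
    exact tendsto_nhds_unique h1 ((hg y).comp (Filter.tendsto_add_atTop_nat 1))
  obtain ⟨hgm, hgB⟩ := hPg
  obtain ⟨B, hfB⟩ := exists_abs_softTransform_le (m := μ₁) hc hK hgm hgB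
  have hfm := measurable_softTransform (m := μ₁) hc hgm
  set f := softTransform μ₁ c g with hf
  -- total mass forces the normalising constant to vanish
  have hS : ∀ y, S g y = g y + S g y₀ := fun y => by
    have := hfix y
    simp only [Φ] at this
    linarith
  set l := S g y₀ with hl
  have hint : Integrable (fun z : X × Y => Real.exp (f z.1 + g z.2 - c z.1 z.2)) (μ₀.prod μ₁) := by
    refine integrable_exp_of_abs_le (B := B + 2 * K + K)
      (((hfm.comp measurable_fst).add (hgm.comp measurable_snd)).sub hc) fun z => ?_
    have h1 := abs_le.1 (hfB z.1)
    have h2 := abs_le.1 (hgB z.2)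
    have h3 := abs_le.1 (hK z.1 z.2)
    exact abs_le.2 ⟨by linarith, by linarith⟩
  have h1 : ∫ z, Real.exp (f z.1 + g z.2 - c z.1 z.2) ∂(μ₀.prod μ₁) = 1 := by
    rw [integral_prod _ hint]
    have : ∀ x, ∫ y, Real.exp (f x + g y - c x y) ∂μ₁ = 1 := by
      intro x
      simp_rw [add_sub_assoc, Real.exp_add (f x)]
      rw [integral_const_mul, ← exp_neg_softTransform hc hK hgm hgB, ← hf, ← Real.exp_add]
      simp
    simp [this]
  have h2 : ∫ z, Real.exp (f z.1 + g z.2 - c z.1 z.2) ∂(μ₀.prod μ₁) = Real.exp (-l) := by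
    rw [integral_prod_symm _ hint]
    have : ∀ y, ∫ x, Real.exp (f x + g y - c x y) ∂μ₀ = Real.exp (-l) := by
      intro y
      have e := exp_neg_softTransform (m := μ₀) hc' hK' hfm hfB y
      have : softTransform μ₀ (flip c) f y = g y + l := hS y
      rw [this] at e
      have : ∀ x, Real.exp (f x + g y - c x y) = Real.exp (g y) * Real.exp (f x - flip c y x) := by
        intro x; rw [← Real.exp_add]; simp only [flip]; ring_nf
      simp_rw [this]
      rw [integral_const_mul, ← e, ← Real.exp_add]
      ring_nf
    simp [this]
  have hl0 : l = 0 := by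
    rw [h1] at h2
    have := Real.exp_eq_one_iff (-l) |>.1 h2.symm
    linarith
  refine ⟨f, g, max B (2 * K), hfm, hgm, fun x => (hfB x).trans (le_max_left _ _),
    fun y => (hgB y).trans (le_max_right _ _), rfl, funext fun y => ?_⟩
  have := hS y
  rw [hl0, add_zero] at this
  exact this.symm

theorem IsCoupling.isProbabilityMeasure {X Y : Type*} [MeasurableSpace X] [MeasurableSpace Y]
    {μ₀ : Measure X} {μ₁ : Measure Y} [IsProbabilityMeasure μ₀] {π : Measure (X × Y)}
    (h : IsCoupling μ₀ μ₁ π) : IsProbabilityMeasure π := by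
  constructor
  rw [← measure_univ (μ := μ₀), ← h.1, Measure.map_apply measurable_fst MeasurableSet.univ,
    Set.preimage_univ]

theorem IsCoupling.integral_add {X Y : Type*} [MeasurableSpace X] [MeasurableSpace Y]
    {μ₀ : Measure X} {μ₁ : Measure Y} [IsProbabilityMeasure μ₀] [IsProbabilityMeasure μ₁]
    {π : Measure (X × Y)} (h : IsCoupling μ₀ μ₁ π) {f : X → ℝ} {g : Y → ℝ} {B : ℝ}
    (hf : Measurable f) (hg : Measurable g) (hfB : ∀ x, |f x| ≤ B) (hgB : ∀ y, |g y| ≤ B) :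
    ∫ z, (f z.1 + g z.2) ∂π = ∫ x, f x ∂μ₀ + ∫ y, g y ∂μ₁ := by
  have := h.isProbabilityMeasure
  rw [MeasureTheory.integral_add, ← h.1, ← h.2,
    integral_map measurable_fst.aemeasurable hf.aestronglyMeasurable,
    integral_map measurable_snd.aemeasurable hg.aestronglyMeasurable]
  · exact Integrable.of_bound (hf.comp measurable_fst).aestronglyMeasurable B
      (ae_of_all _ fun z => hfB z.1)
  · exact Integrable.of_bound (hg.comp measurable_snd).aestronglyMeasurable B
      (ae_of_all _ fun z => hgB z.2)

/-- A bounded cost admits Schrödinger potentials, with quantitative bounds. -/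
theorem exists_schrodinger_potentials {X Y : Type*} [MeasurableSpace X] [MeasurableSpace Y]
    (μ₀ : Measure X) (μ₁ : Measure Y) [IsProbabilityMeasure μ₀] [IsProbabilityMeasure μ₁]
    {κ : X × Y → ℝ} {K : ℝ} (hκ : AEMeasurable κ (μ₀.prod μ₁)) (hK0 : 0 ≤ K)
    (hK : ∀ᵐ z ∂(μ₀.prod μ₁), |κ z| ≤ K) :
    ∃ (f : X → ℝ) (g : Y → ℝ) (B : ℝ), Measurable f ∧ Measurable g ∧ (∀ x, |f x| ≤ B) ∧
      (∀ y, |g y| ≤ B) ∧ (∀ x x', |f x - f x'| ≤ 2 * K) ∧ (∀ y y', |g y - g y'| ≤ 2 * K) ∧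
      (∀ z : X × Y, |f z.1 + g z.2| ≤ 3 * K) ∧
      IsCoupling μ₀ μ₁ (((μ₀.prod μ₁).withDensity
        fun z => ENNReal.ofReal (Real.exp (-κ z))).withDensity
          fun z => ENNReal.ofReal (Real.exp (f z.1 + g z.2))) := by
  -- Clipping a measurable version gives a bound at every point and alters κ only on a null set.
  let c : X → Y → ℝ := fun x y => max (-K) (min K (hκ.mk κ (x, y)))
  have hc : Measurable (Function.uncurry c) :=
    measurable_const.max (measurable_const.min hκ.measurable_mk)
  have hcK : ∀ x y, |c x y| ≤ K := fun x y =>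
    abs_le.2 ⟨le_max_left _ _, max_le (by linarith) (min_le_left _ _)⟩
  have hcκ : ∀ᵐ z ∂(μ₀.prod μ₁), κ z = c z.1 z.2 := by
    filter_upwards [hκ.ae_eq_mk, hK] with z hz1 hz2
    have h := abs_le.1 hz2
    simp only [c, Prod.mk.eta, ← hz1]
    rw [min_eq_right h.2, max_eq_right h.1]
  have hc' : Measurable (Function.uncurry (flip c)) := hc.comp measurable_swap
  have hcK' : ∀ y x, |flip c y x| ≤ K := fun y x => hcK x y
  obtain ⟨f, g, B, hf, hg, hfB, hgB, hfg, hgf⟩ := exists_softTransform_eq μ₀ μ₁ hc hcK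
  have hof : ∀ x x', |f x - f x'| ≤ 2 * K := by
    rw [hfg]; exact abs_softTransform_sub_le hc hcK hg hgB
  have hog : ∀ y y', |g y - g y'| ≤ 2 * K := by
    rw [hgf]; exact abs_softTransform_sub_le hc' hcK' hf hfB
  have ef : ∀ x, Real.exp (-f x) = ∫ y, Real.exp (g y - c x y) ∂μ₁ := fun x => by
    rw [congrFun hfg x]; exact exp_neg_softTransform hc hcK hg hgB x
  have eg : ∀ y, Real.exp (-g y) = ∫ x, Real.exp (f x - c x y) ∂μ₀ := fun y => by
    rw [congrFun hgf y]; exact exp_neg_softTransform hc' hcK' hf hfB y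
  have hif := integrable_exp_sub (m := μ₁) hc hcK hg hgB
  have hig : ∀ y, Integrable (fun x => Real.exp (f x - c x y)) μ₀ :=
    integrable_exp_sub hc' hcK' hf hfB
  -- In e^(-f x) = ∫ e^(g y' - c x y') dμ₁(y'), replacing g y' by g y costs 2K and dropping c costs
  -- K. Unlike `B`, this bound is explicit and unaffected by shifting a constant between f and g.
  have hbd : ∀ z : X × Y, |f z.1 + g z.2| ≤ 3 * K := by
    rintro ⟨x, y⟩
    have h1 : Real.exp (g y - 3 * K) ≤ Real.exp (-f x) := by
      rw [ef]
      calc Real.exp (g y - 3 * K) = ∫ _ : Y, Real.exp (g y - 3 * K) ∂μ₁ := by simp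
        _ ≤ _ := by
          refine integral_mono (integrable_const _) (hif x) fun y' => Real.exp_le_exp.2 ?_
          have h1 := abs_le.1 (hog y y')
          have h2 := abs_le.1 (hcK x y')
          linarith
    have h2 : Real.exp (-f x) ≤ Real.exp (g y + 3 * K) := by
      rw [ef]
      calc _ ≤ ∫ _ : Y, Real.exp (g y + 3 * K) ∂μ₁ := by
            refine integral_mono (hif x) (integrable_const _) fun y' => Real.exp_le_exp.2 ?_
            have h1 := abs_le.1 (hog y y')
            have h2 := abs_le.1 (hcK x y')
            linarith
        _ = _ := by simp
    rw [Real.exp_le_exp] at h1 h2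
    exact abs_le.2 ⟨by dsimp only; linarith, by dsimp only; linarith⟩
  refine ⟨f, g, B, hf, hg, hfB, hgB, hof, hog, hbd, ?_⟩
  have hφ : Measurable fun z : X × Y => f z.1 + g z.2 :=
    (hf.comp measurable_fst).add (hg.comp measurable_snd)
  have hd : Measurable fun z : X × Y => ENNReal.ofReal (Real.exp (f z.1 + g z.2 - c z.1 z.2)) :=
    (hφ.sub hc).exp.ennreal_ofReal
  have hP : ((μ₀.prod μ₁).withDensity fun z => ENNReal.ofReal (Real.exp (-κ z))).withDensity
      (fun z => ENNReal.ofReal (Real.exp (f z.1 + g z.2))) =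
      (μ₀.prod μ₁).withDensity
        fun z => ENNReal.ofReal (Real.exp (f z.1 + g z.2 - c z.1 z.2)) := by
    rw [← withDensity_mul₀ hκ.fun_neg.exp.ennreal_ofReal hφ.exp.ennreal_ofReal.aemeasurable]
    refine withDensity_congr_ae ?_
    filter_upwards [hcκ] with z hz
    rw [Pi.mul_apply, ← ENNReal.ofReal_mul (Real.exp_pos _).le, ← Real.exp_add, hz]
    ring_nf
  rw [hP]
  constructor
  · ext s hs
    rw [Measure.map_apply measurable_fst hs, withDensity_apply _ (measurable_fst hs),
      ← Set.prod_univ, ← Measure.prod_restrict, Measure.restrict_univ,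
      lintegral_prod _ hd.aemeasurable]
    have : ∀ x, ∫⁻ y, ENNReal.ofReal (Real.exp (f x + g y - c x y)) ∂μ₁ = 1 := by
      intro x
      have e : ∀ y, Real.exp (f x + g y - c x y) = Real.exp (f x) * Real.exp (g y - c x y) :=
        fun y => by rw [← Real.exp_add]; ring_nf
      simp_rw [e]
      rw [← ofReal_integral_eq_lintegral_ofReal ((hif x).const_mul _)
        (ae_of_all _ fun y => by positivity), integral_const_mul, ← ef, ← Real.exp_add]
      simp
    simp [this]
  · ext s hs
    rw [Measure.map_apply measurable_snd hs, withDensity_apply _ (measurable_snd hs),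
      ← Set.univ_prod, ← Measure.prod_restrict, Measure.restrict_univ,
      lintegral_prod_symm _ hd.aemeasurable]
    have : ∀ y, ∫⁻ x, ENNReal.ofReal (Real.exp (f x + g y - c x y)) ∂μ₀ = 1 := by
      intro y
      have e : ∀ x, Real.exp (f x + g y - c x y) = Real.exp (g y) * Real.exp (f x - c x y) :=
        fun x => by rw [← Real.exp_add]; ring_nf
      simp_rw [e]
      rw [← ofReal_integral_eq_lintegral_ofReal ((hig y).const_mul _)
        (ae_of_all _ fun x => by positivity), integral_const_mul, ← eg, ← Real.exp_add]
      simp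
    simp [this]

/-- A coupling whose density with respect to `R` is `exp (f ⊕ g)` is the unique bridge. -/
theorem isSchrodingerBridge_iff_eq {X Y : Type*} [MeasurableSpace X] [MeasurableSpace Y]
    {μ₀ : Measure X} {μ₁ : Measure Y} [IsProbabilityMeasure μ₀] [IsProbabilityMeasure μ₁]
    {R P : Measure (X × Y)} [IsProbabilityMeasure R] {f : X → ℝ} {g : Y → ℝ} {B : ℝ}
    (hf : Measurable f) (hg : Measurable g) (hfB : ∀ x, |f x| ≤ B) (hgB : ∀ y, |g y| ≤ B)
    (hP : P = R.withDensity fun z => ENNReal.ofReal (Real.exp (f z.1 + g z.2)))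
    (hPc : IsCoupling μ₀ μ₁ P) (π : Measure (X × Y)) :
    IsSchrodingerBridge μ₀ μ₁ R π ↔ π = P := by
  have hPp := hPc.isProbabilityMeasure
  let φ : X × Y → ℝ := fun z => f z.1 + g z.2
  have hφ : Measurable φ := (hf.comp measurable_fst).add (hg.comp measurable_snd)
  have hφB : ∀ z, |φ z| ≤ B + B := fun z => (abs_add_le _ _).trans (add_le_add (hfB _) (hgB _))
  have hexp : Integrable (fun z => Real.exp (φ z)) R := integrable_exp_of_abs_le hφ hφB
  have hone : ∫ z, Real.exp (φ z) ∂(R) = 1 := by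
    have h : P Set.univ = 1 := measure_univ
    rw [hP, withDensity_apply _ MeasurableSet.univ, Measure.restrict_univ,
      ← ofReal_integral_eq_lintegral_ofReal hexp (ae_of_all _ fun z => (Real.exp_pos _).le)] at h
    simpa using h
  have hPt : P = R.tilted φ := by
    rw [hP, Measure.tilted, hone]
    simp [φ]
  set C := ∫ x, f x ∂μ₀ + ∫ y, g y ∂μ₁ with hC
  have hφi : ∀ H : Measure (X × Y), IsCoupling μ₀ μ₁ H → Integrable φ H := fun H hH => by
    have := hH.isProbabilityMeasure
    exact Integrable.of_bound hφ.aestronglyMeasurable _ (ae_of_all _ hφB)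
  have hφC : ∀ H : Measure (X × Y), IsCoupling μ₀ μ₁ H → ∫ z, φ z ∂H = C := fun H hH =>
    hH.integral_add hf hg hfB hgB
  have hac : P ≪ R := hPt ▸ tilted_absolutelyContinuous R φ
  have hllr : llr P R =ᵐ[P] φ := by
    refine hac.ae_le ?_
    have h := log_rnDeriv_tilted_left_self hexp
    rw [hone, ← hPt] at h
    filter_upwards [h] with z hz
    simpa [llr] using hz
  have hkl : InformationTheory.klDiv P R = ENNReal.ofReal C := by
    rw [InformationTheory.klDiv_of_ac_of_integrable hac ((hφi P hPc).congr hllr.symm),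
      integral_congr_ae hllr, hφC P hPc]
    simp
  have hCnn : 0 ≤ C := by
    have := InformationTheory.integral_llr_add_sub_measure_univ_nonneg hac
      ((hφi P hPc).congr hllr.symm)
    rw [integral_congr_ae hllr, hφC P hPc] at this
    simpa using this
  -- Pythagorean identity KL(H‖R) = KL(H‖P) + C: log dP/dR = φ has the same integral C against every
  -- coupling. Here t = KL(H‖P), which vanishes only for H = P.
  have hmain : ∀ H : Measure (X × Y), IsCoupling μ₀ μ₁ H →
      InformationTheory.klDiv H R ≠ ⊤ → ∃ t : ℝ, 0 ≤ t ∧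
        InformationTheory.klDiv H R = ENNReal.ofReal (t + C) ∧
        InformationTheory.klDiv H P = ENNReal.ofReal t := by
    intro H hH htop
    have hHp := hH.isProbabilityMeasure
    obtain ⟨hHR, hint⟩ := InformationTheory.klDiv_ne_top_iff.1 htop
    have hHP : H ≪ P := hHR.trans (hPt ▸ absolutelyContinuous_tilted hexp)
    have hint' : Integrable (llr H P) H := by
      rw [hPt]; exact integrable_llr_tilted_right hHR (hφi H hH) hint hexp
    have hval : ∫ z, llr H P z ∂H = ∫ z, llr H R z ∂H - C := by
      rw [hPt, integral_llr_tilted_right hHR (hφi H hH) hexp hint, hone, hφC H hH]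
      simp
    refine ⟨∫ z, llr H R z ∂H - C, ?_, ?_, ?_⟩
    · have := InformationTheory.integral_llr_add_sub_measure_univ_nonneg hHP hint'
      rw [hval] at this
      simpa using this
    · rw [InformationTheory.klDiv_of_ac_of_integrable hHR hint]
      simp
    · rw [InformationTheory.klDiv_of_ac_of_integrable hHP hint', hval]
      simp
  constructor
  · rintro ⟨hπc, hπ⟩
    have hπp := hπc.isProbabilityMeasure
    have hle := hπ P hPc
    rw [hkl] at hle
    obtain ⟨t, ht, h1, h2⟩ := hmain π hπc (hle.trans_lt ENNReal.ofReal_lt_top).ne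
    rw [h1, ENNReal.ofReal_le_ofReal_iff hCnn] at hle
    rw [← InformationTheory.klDiv_eq_zero_iff, h2, ENNReal.ofReal_eq_zero]
    linarith
  · rintro rfl
    refine ⟨hPc, fun H hH => ?_⟩
    by_cases htop : InformationTheory.klDiv H R = ⊤
    · rw [htop]; exact le_top
    · obtain ⟨t, ht, h1, -⟩ := hmain H hH htop
      rw [hkl, h1]
      exact ENNReal.ofReal_le_ofReal (by linarith)

/-! ### Hellinger distance between exponential tilts -/

/-- This is the discriminant condition for the quadratic form in (s, t) of the next lemma. With x =
e^L it follows from x - 1 ≤ Lx and x(x - 1) ≤ x² - 1 - L. -/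
theorem sq_sub_one_le_mul_exp_sub {L : ℝ} (hL : 0 ≤ L) :
    (Real.exp L - 1) ^ 2 ≤ L * (Real.exp L ^ 2 - 1 - L) := by
  have h1 : L + 1 ≤ Real.exp L := Real.add_one_le_exp L
  have h2 : -L + 1 ≤ Real.exp (-L) := Real.add_one_le_exp (-L)
  have h3 : Real.exp L * Real.exp (-L) = 1 := by rw [← Real.exp_add]; simp
  have hx := Real.exp_pos L
  set x := Real.exp L
  have h4 : x - 1 ≤ L * x := by nlinarith [mul_le_mul_of_nonneg_left h2 hx.le]
  have h5 : x * (x - 1) ≤ x ^ 2 - 1 - L := by nlinarith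
  nlinarith [mul_le_mul_of_nonneg_left h5 hL, mul_le_mul_of_nonneg_right h4 (by linarith : 0 ≤ x - 1)]

/-- With s, t the square roots of the reference densities, the left side is the Hellinger integrand
of the tilts, and the last term integrates to half the difference of the integrals of φ-ψ. -/
theorem sq_exp_mul_sub_le_of_le {φ ψ B s t : ℝ} (h : ψ ≤ φ) (hB : φ ≤ B) :
    (Real.exp (φ / 2) * s - Real.exp (ψ / 2) * t) ^ 2 ≤ Real.exp B * (s - t) ^ 2 +
      1 / 2 * (φ - ψ) * (Real.exp φ * s ^ 2 - Real.exp ψ * t ^ 2) := by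
  obtain ⟨L, rfl⟩ : ∃ L, φ = ψ + 2 * L := ⟨(φ - ψ) / 2, by ring⟩
  have hL : 0 ≤ L := by linarith
  have hkey := sq_sub_one_le_mul_exp_sub hL
  have hy := Real.exp_pos (ψ / 2)
  have e1 : Real.exp ((ψ + 2 * L) / 2) = Real.exp (ψ / 2) * Real.exp L := by
    rw [← Real.exp_add]; ring_nf
  have e2 : Real.exp ψ = Real.exp (ψ / 2) ^ 2 := by
    rw [← Real.exp_nat_mul]; ring_nf
  have e3 : Real.exp (ψ + 2 * L) = Real.exp (ψ / 2) ^ 2 * Real.exp L ^ 2 := by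
    rw [← Real.exp_nat_mul, ← Real.exp_nat_mul, ← Real.exp_add]; ring_nf
  have hB' := mul_le_mul_of_nonneg_right (Real.exp_le_exp.2 hB) (sq_nonneg (s - t))
  rw [e3] at hB'
  rw [e1, e2, e3]
  set y := Real.exp (ψ / 2)
  set x := Real.exp L with hx
  have main : (x * s - t) ^ 2 ≤ x ^ 2 * (s - t) ^ 2 + L * (x ^ 2 * s ^ 2 - t ^ 2) := by
    rcases hL.eq_or_lt with h0 | h0
    · have : x = 1 := by rw [hx, ← h0, Real.exp_zero]
      rw [this, ← h0]
      linarith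
    -- Multiplying by L > 0 allows completing the square; the remainder is t² times the discriminant
    -- gap.
    · have : 0 ≤ L * (x ^ 2 * (s - t) ^ 2 + L * (x ^ 2 * s ^ 2 - t ^ 2) - (x * s - t) ^ 2) := by
        nlinarith [sq_nonneg (L * (x * s) - t * (x - 1)),
          mul_nonneg (sq_nonneg t) (sub_nonneg.2 hkey)]
      linarith [nonneg_of_mul_nonneg_right this h0]
  nlinarith [mul_le_mul_of_nonneg_left main (sq_nonneg y)]

theorem sq_exp_mul_sub_le {φ ψ B s t : ℝ} (hφ : φ ≤ B) (hψ : ψ ≤ B) :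
    (Real.exp (φ / 2) * s - Real.exp (ψ / 2) * t) ^ 2 ≤ Real.exp B * (s - t) ^ 2 +
      1 / 2 * (φ - ψ) * (Real.exp φ * s ^ 2 - Real.exp ψ * t ^ 2) := by
  rcases le_total ψ φ with h | h
  · exact sq_exp_mul_sub_le_of_le h hφ
  · have := sq_exp_mul_sub_le_of_le (s := t) (t := s) h hψ
    linarith

section Hellinger

variable {Z : Type*} [MeasurableSpace Z]

theorem hellingerSq_nonneg (σ P Q : Measure Z) : 0 ≤ hellingerSq σ P Q :=
  integral_nonneg fun _ => sq_nonneg _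

theorem hellingerDist_sq (σ P Q : Measure Z) [SigmaFinite σ] [IsFiniteMeasure P]
    [IsFiniteMeasure Q] (hP : P ≪ σ) (hQ : Q ≪ σ) :
    hellingerDist P Q ^ 2 = hellingerSq σ P Q := by
  rw [hellingerDist_eq σ P Q hP hQ, Real.sq_sqrt (hellingerSq_nonneg _ _ _)]

theorem integrable_hellinger (σ P Q : Measure Z) [IsFiniteMeasure P] [IsFiniteMeasure Q] :
    Integrable (fun z => (√((P.rnDeriv σ z).toReal) - √((Q.rnDeriv σ z).toReal)) ^ 2) σ := by
  refine Integrable.mono' ((Measure.integrable_toReal_rnDeriv (μ := P) (ν := σ)).add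
    (Measure.integrable_toReal_rnDeriv (μ := Q) (ν := σ))) ?_ (ae_of_all _ fun z => ?_)
  · exact (((Measure.measurable_rnDeriv P σ).ennreal_toReal.sqrt.sub
      (Measure.measurable_rnDeriv Q σ).ennreal_toReal.sqrt).pow_const 2).aestronglyMeasurable
  · rw [Real.norm_eq_abs, abs_of_nonneg (sq_nonneg _), Pi.add_apply]
    have h1 := Real.sq_sqrt (ENNReal.toReal_nonneg (a := P.rnDeriv σ z))
    have h2 := Real.sq_sqrt (ENNReal.toReal_nonneg (a := Q.rnDeriv σ z))
    nlinarith [mul_nonneg (Real.sqrt_nonneg (P.rnDeriv σ z).toReal)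
      (Real.sqrt_nonneg (Q.rnDeriv σ z).toReal)]

theorem hellingerDist_sq_le_two_mul_add (P Q S : Measure Z) [IsFiniteMeasure P]
    [IsFiniteMeasure Q] [IsFiniteMeasure S] :
    hellingerDist P S ^ 2 ≤ 2 * hellingerDist P Q ^ 2 + 2 * hellingerDist Q S ^ 2 := by
  set σ := P + Q + S
  have hP : P ≪ σ :=
    Measure.absolutelyContinuous_of_le (Measure.le_add_right (Measure.le_add_right le_rfl))
  have hQ : Q ≪ σ :=
    Measure.absolutelyContinuous_of_le (Measure.le_add_right (Measure.le_add_left le_rfl))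
  have hS : S ≪ σ := Measure.absolutelyContinuous_of_le (Measure.le_add_left le_rfl)
  rw [hellingerDist_sq σ P S hP hS, hellingerDist_sq σ P Q hP hQ, hellingerDist_sq σ Q S hQ hS]
  unfold hellingerSq
  have i1 := (integrable_hellinger σ P Q).const_mul 2
  have i2 := (integrable_hellinger σ Q S).const_mul 2
  rw [← integral_const_mul, ← integral_const_mul, ← integral_add i1 i2]
  refine integral_mono (integrable_hellinger σ P S) (i1.add i2) fun z => ?_
  dsimp only
  nlinarith [sq_nonneg (√((P.rnDeriv σ z).toReal) - 2 * √((Q.rnDeriv σ z).toReal) +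
    √((S.rnDeriv σ z).toReal))]

theorem hellingerDist_self (P : Measure Z) [IsFiniteMeasure P] : hellingerDist P P = 0 := by
  simp [hellingerDist, hellingerSq]

/-- Hellinger distance between two exponential tilts of different reference measures. -/
theorem hellingerDist_withDensity_exp_sq_le {R R' P P' : Measure Z} [IsFiniteMeasure R]
    [IsFiniteMeasure R'] [IsFiniteMeasure P] [IsFiniteMeasure P'] {φ ψ : Z → ℝ} {B : ℝ}
    (hφ : Measurable φ) (hψ : Measurable ψ) (hφB : ∀ z, |φ z| ≤ B) (hψB : ∀ z, |ψ z| ≤ B)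
    (hP : P = R.withDensity fun z => ENNReal.ofReal (Real.exp (φ z)))
    (hP' : P' = R'.withDensity fun z => ENNReal.ofReal (Real.exp (ψ z))) :
    hellingerDist P P' ^ 2 ≤ Real.exp B * hellingerDist R R' ^ 2 +
      1 / 2 * (∫ z, (φ z - ψ z) ∂P - ∫ z, (φ z - ψ z) ∂P') := by
  set σ := R + R'
  have hRσ : R ≪ σ := Measure.absolutelyContinuous_of_le (Measure.le_add_right le_rfl)
  have hRσ' : R' ≪ σ := Measure.absolutelyContinuous_of_le (Measure.le_add_left le_rfl)
  have hPσ : P ≪ σ := (hP ▸ withDensity_absolutelyContinuous R _ : P ≪ R).trans hRσ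
  have hPσ' : P' ≪ σ := (hP' ▸ withDensity_absolutelyContinuous R' _ : P' ≪ R').trans hRσ'
  have dP : P.rnDeriv σ =ᵐ[σ] fun z => ENNReal.ofReal (Real.exp (φ z)) * R.rnDeriv σ z := by
    rw [hP]
    exact Measure.rnDeriv_withDensity_left_of_absolutelyContinuous hRσ
      hφ.exp.ennreal_ofReal.aemeasurable
  have dP' : P'.rnDeriv σ =ᵐ[σ] fun z => ENNReal.ofReal (Real.exp (ψ z)) * R'.rnDeriv σ z := by
    rw [hP']
    exact Measure.rnDeriv_withDensity_left_of_absolutelyContinuous hRσ'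
      hψ.exp.ennreal_ofReal.aemeasurable
  have hint : ∀ (Q : Measure Z) [IsFiniteMeasure Q], Integrable (fun z => φ z - ψ z) Q := by
    intro Q _
    exact Integrable.of_bound (hφ.sub hψ).aestronglyMeasurable (B + B)
      (ae_of_all _ fun z => (abs_sub _ _).trans (add_le_add (hφB z) (hψB z)))
  have i0 := (integrable_hellinger σ R R').const_mul (Real.exp B)
  have i1 := (integrable_rnDeriv_smul_iff hPσ).2 (hint P)
  have i2 := (integrable_rnDeriv_smul_iff hPσ').2 (hint P')
  rw [hellingerDist_sq σ P P' hPσ hPσ', hellingerDist_sq σ R R' hRσ hRσ',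
    ← integral_rnDeriv_smul hPσ, ← integral_rnDeriv_smul hPσ', ← integral_sub i1 i2]
  unfold hellingerSq
  have i3 : Integrable (fun z => 1 / 2 * ((P.rnDeriv σ z).toReal • (φ z - ψ z) -
      (P'.rnDeriv σ z).toReal • (φ z - ψ z))) σ := (i1.sub i2).const_mul (1 / 2)
  rw [← integral_const_mul, ← integral_const_mul, ← integral_add i0 i3]
  refine integral_mono_ae (integrable_hellinger σ P P') (i0.add i3) ?_
  filter_upwards [dP, dP'] with z h1 h2
  simp only [smul_eq_mul]
  rw [h1, h2, ENNReal.toReal_mul, ENNReal.toReal_mul, ENNReal.toReal_ofReal (Real.exp_pos _).le,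
    ENNReal.toReal_ofReal (Real.exp_pos _).le, Real.sqrt_mul (Real.exp_pos _).le,
    Real.sqrt_mul (Real.exp_pos _).le, ← Real.exp_half, ← Real.exp_half]
  have := sq_exp_mul_sub_le (s := √((R.rnDeriv σ z).toReal)) (t := √((R'.rnDeriv σ z).toReal))
    (le_of_abs_le (hφB z)) (le_of_abs_le (hψB z))
  rw [Real.sq_sqrt ENNReal.toReal_nonneg, Real.sq_sqrt ENNReal.toReal_nonneg] at this
  linarith

end Hellinger

/-! ### Changing marginals and base measure -/

/-- Integrals of a function of bounded oscillation against two probability measures. -/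
theorem integral_sub_le_of_osc_le {X : Type*} [MeasurableSpace X] {μ μ₀ μ₀' : Measure X}
    [IsProbabilityMeasure μ₀] [IsProbabilityMeasure μ₀'] {ρ ρ' : X → ℝ}
    (hρ : Measurable ρ) (hρ' : Measurable ρ') (hpos : ∀ᵐ x ∂μ, 0 < ρ x)
    (hpos' : ∀ᵐ x ∂μ, 0 < ρ' x) (h₀ : μ₀ = μ.withDensity fun x => ENNReal.ofReal (ρ x))
    (h₀' : μ₀' = μ.withDensity fun x => ENNReal.ofReal (ρ' x)) {u : X → ℝ} {C : ℝ}
    (hu : Measurable u) (hC : ∀ x x', |u x - u x'| ≤ C) :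
    ∫ x, u x ∂μ₀ - ∫ x, u x ∂μ₀' ≤ C * ∫ x, |ρ x - ρ' x| ∂μ := by
  obtain ⟨x₀⟩ : Nonempty X := nonempty_of_isProbabilityMeasure μ₀
  -- Both measures have mass one, so subtracting u x₀ is harmless and makes the integrand bounded by
  -- C.
  have hv : Measurable fun x => u x - u x₀ := hu.sub_const _
  have aux : ∀ (m : Measure X) [IsProbabilityMeasure m] (r : X → ℝ), Measurable r →
      (∀ᵐ x ∂μ, 0 < r x) → m = μ.withDensity (fun x => ENNReal.ofReal (r x)) →
      Integrable r μ ∧ ∫ x, u x ∂m = ∫ x, r x * (u x - u x₀) ∂μ + u x₀ := by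
    intro m _ r hr hrpos hm
    constructor
    · refine ⟨hr.aestronglyMeasurable, ?_⟩
      rw [hasFiniteIntegral_iff_ofReal (hrpos.mono fun x hx => hx.le)]
      have h : m Set.univ = 1 := measure_univ
      rw [hm, withDensity_apply _ MeasurableSet.univ, Measure.restrict_univ] at h
      rw [h]; exact ENNReal.one_lt_top
    · have hi : Integrable (fun x => u x - u x₀) m :=
        Integrable.of_bound hv.aestronglyMeasurable C (ae_of_all _ fun x => hC x x₀)
      have h1 : ∫ x, u x ∂m = ∫ x, (u x - u x₀) ∂m + u x₀ := by
        calc ∫ x, u x ∂m = ∫ x, ((u x - u x₀) + u x₀) ∂m := by simp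
          _ = _ := by rw [integral_add hi (integrable_const _)]; simp
      rw [h1, hm, integral_withDensity_eq_integral_toReal_smul hr.ennreal_ofReal
        (ae_of_all _ fun x => ENNReal.ofReal_lt_top)]
      congr 1
      refine integral_congr_ae ?_
      filter_upwards [hrpos] with x hx
      rw [ENNReal.toReal_ofReal hx.le, smul_eq_mul]
  obtain ⟨i, e⟩ := aux μ₀ ρ hρ hpos h₀
  obtain ⟨i', e'⟩ := aux μ₀' ρ' hρ' hpos' h₀'
  have hvb : ∀ᵐ x ∂μ, ‖u x - u x₀‖ ≤ C := ae_of_all _ fun x => hC x x₀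
  have j := i.mul_bdd hv.aestronglyMeasurable hvb
  have j' := i'.mul_bdd hv.aestronglyMeasurable hvb
  rw [e, e', add_sub_add_right_eq_sub, ← integral_sub j j', ← integral_const_mul]
  refine integral_mono (j.sub j') ((i.sub i').abs.const_mul C) fun x => ?_
  dsimp only
  rw [← sub_mul, mul_comm C]
  refine (le_abs_self _).trans ?_
  rw [abs_mul]
  exact mul_le_mul_of_nonneg_left (hC x x₀) (abs_nonneg _)

theorem ae_abs_le_linftyNorm {Z : Type*} [MeasurableSpace Z] {σ : Measure Z} {f : Z → ℝ}
    (hf : MemLp f ⊤ σ) : ∀ᵐ z ∂σ, |f z| ≤ linftyNorm σ f := by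
  have h := hf.eLpNorm_lt_top
  unfold linftyNorm
  rw [eLpNorm_exponent_top] at h ⊢
  filter_upwards [ae_le_eLpNormEssSup (f := f) (μ := σ)] with z hz
  have := ENNReal.toReal_mono h.ne hz
  simpa using this

/-- If the density `dm/dm'` lies in `[exp (-M), exp M]`, a cost bounded by `K` with respect to `m`
becomes a cost bounded by `K + M` with respect to `m'`. -/
theorem exists_cost_change_of_reference {Z : Type*} [MeasurableSpace Z] {m m' : Measure Z}
    [IsFiniteMeasure m] [IsFiniteMeasure m'] {κ : Z → ℝ} {K M : ℝ} (hmm' : m ≪ m')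
    (hratio : ∀ᵐ z ∂m', ENNReal.ofReal (Real.exp (-M)) ≤ m.rnDeriv m' z ∧
      m.rnDeriv m' z ≤ ENNReal.ofReal (Real.exp M))
    (hκ : AEMeasurable κ m) (hK : ∀ᵐ z ∂m, |κ z| ≤ K) :
    ∃ θ : Z → ℝ, AEMeasurable θ m' ∧ (∀ᵐ z ∂m', |θ z| ≤ K + M) ∧
      m.withDensity (fun z => ENNReal.ofReal (Real.exp (-κ z))) =
        m'.withDensity fun z => ENNReal.ofReal (Real.exp (-θ z)) := by
  -- The positive lower bound on the density makes the two measures equivalent, so the bound on κ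
  -- also holds m'-a.e.
  have hback : m' ≪ m := by
    rw [← Measure.withDensity_rnDeriv_eq m m' hmm']
    refine withDensity_absolutelyContinuous' (Measure.measurable_rnDeriv m m').aemeasurable ?_
    filter_upwards [hratio] with z hz
    exact ((ENNReal.ofReal_pos.2 (Real.exp_pos _)).trans_le hz.1).ne'
  have hκ' : AEMeasurable κ m' := hκ.mono_ac hback
  have hlog : ∀ᵐ z ∂m', m.rnDeriv m' z = ENNReal.ofReal (Real.exp (llr m m' z)) ∧
      |llr m m' z| ≤ M := by
    filter_upwards [hratio] with z hz
    have htop : m.rnDeriv m' z ≠ ⊤ := (hz.2.trans_lt ENNReal.ofReal_lt_top).ne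
    have h1 := (ENNReal.ofReal_le_iff_le_toReal htop).1 hz.1
    have h2 := ENNReal.toReal_le_of_le_ofReal (Real.exp_pos _).le hz.2
    have hpos := (Real.exp_pos _).trans_le h1
    unfold llr
    refine ⟨by rw [Real.exp_log hpos, ENNReal.ofReal_toReal htop], abs_le.2 ⟨?_, ?_⟩⟩
    · exact (Real.le_log_iff_exp_le hpos).2 h1
    · exact (Real.log_le_iff_le_exp hpos).2 h2
  refine ⟨fun z => κ z - llr m m' z, hκ'.sub (measurable_llr m m').aemeasurable, ?_, ?_⟩
  · filter_upwards [hlog, hback.ae_le hK] with z hz hKz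
    exact (abs_sub _ _).trans (add_le_add hKz hz.2)
  · conv_lhs => rw [← Measure.withDensity_rnDeriv_eq m m' hmm']
    rw [← withDensity_mul₀ (Measure.measurable_rnDeriv m m').aemeasurable
      hκ'.fun_neg.exp.ennreal_ofReal]
    refine withDensity_congr_ae ?_
    filter_upwards [hlog] with z hz
    rw [Pi.mul_apply, hz.1, ← ENNReal.ofReal_mul (Real.exp_pos _).le, ← Real.exp_add]
    ring_nf

/-! ### The stability estimate -/

theorem mainTheorem9 {X Y : Type*} [MeasurableSpace X] [MeasurableSpace Y]
    (μ : Measure X) (ν : Measure Y) [IsProbabilityMeasure μ] [IsProbabilityMeasure ν]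
    (μ₀ μ₀' : Measure X) (μ₁ μ₁' : Measure Y)
    [IsProbabilityMeasure μ₀] [IsProbabilityMeasure μ₀']
    [IsProbabilityMeasure μ₁] [IsProbabilityMeasure μ₁']
    (ρr ρr' : X → ℝ) (ρc ρc' : Y → ℝ)
    (hρr_meas : Measurable ρr) (hρr'_meas : Measurable ρr')
    (hρc_meas : Measurable ρc) (hρc'_meas : Measurable ρc')
    (hρr_pos : ∀ᵐ x ∂μ, 0 < ρr x) (hρr'_pos : ∀ᵐ x ∂μ, 0 < ρr' x)
    (hρc_pos : ∀ᵐ y ∂ν, 0 < ρc y) (hρc'_pos : ∀ᵐ y ∂ν, 0 < ρc' y)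
    (hμ₀ : μ₀ = μ.withDensity (fun x => ENNReal.ofReal (ρr x)))
    (hμ₀' : μ₀' = μ.withDensity (fun x => ENNReal.ofReal (ρr' x)))
    (hμ₁ : μ₁ = ν.withDensity (fun y => ENNReal.ofReal (ρc y)))
    (hμ₁' : μ₁' = ν.withDensity (fun y => ENNReal.ofReal (ρc' y)))
    (R R' : Measure (X × Y)) [IsProbabilityMeasure R] [IsProbabilityMeasure R']
    (κ κ' : X × Y → ℝ)
    (hκ : MemLp κ ⊤ (μ₀.prod μ₁)) (hκ' : MemLp κ' ⊤ (μ₀'.prod μ₁'))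
    (hR : R = (μ₀.prod μ₁).withDensity (fun z => ENNReal.ofReal (Real.exp (-κ z))))
    (hR' : R' = (μ₀'.prod μ₁').withDensity (fun z => ENNReal.ofReal (Real.exp (-κ' z))))
    (M : ℝ) (hM : 0 ≤ M)
    (hratio : ∀ᵐ z ∂(μ.prod ν),
      ENNReal.ofReal (Real.exp (-M)) ≤ (μ₀.prod μ₁).rnDeriv (μ₀'.prod μ₁') z ∧
        (μ₀.prod μ₁).rnDeriv (μ₀'.prod μ₁') z ≤ ENNReal.ofReal (Real.exp M)) :
    (∃! π : Measure (X × Y), IsSchrodingerBridge μ₀ μ₁ R π) ∧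
    (∃! π' : Measure (X × Y), IsSchrodingerBridge μ₀' μ₁' R' π') ∧
    ∀ π π' : Measure (X × Y),
      IsSchrodingerBridge μ₀ μ₁ R π → IsSchrodingerBridge μ₀' μ₁' R' π' →
      hellingerDist π π' ^ 2 ≤
        8 * (linftyNorm (μ₀.prod μ₁) κ + M) *
            ((∫ x, |ρr x - ρr' x| ∂μ) + ∫ y, |ρc y - ρc' y| ∂ν) +
          4 * Real.exp (3 * max (linftyNorm (μ₀.prod μ₁) κ + M) (linftyNorm (μ₀'.prod μ₁') κ')) *
            hellingerDist R R' ^ 2 := by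
  set m := μ₀.prod μ₁ with hm
  set m' := μ₀'.prod μ₁' with hm'
  have hκb := ae_abs_le_linftyNorm hκ
  have hκb' := ae_abs_le_linftyNorm hκ'
  have hN : 0 ≤ linftyNorm m κ := ENNReal.toReal_nonneg
  have hN' : 0 ≤ linftyNorm m' κ' := ENNReal.toReal_nonneg
  have hmμ : m ≪ μ.prod ν := by
    rw [hm, hμ₀, hμ₁]
    exact (withDensity_absolutelyContinuous μ _).prod (withDensity_absolutelyContinuous ν _)
  have hmμ' : m' ≪ μ.prod ν := by
    rw [hm', hμ₀', hμ₁']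
    exact (withDensity_absolutelyContinuous μ _).prod (withDensity_absolutelyContinuous ν _)
  have hμm' : μ.prod ν ≪ m' := by
    rw [hm', hμ₀', hμ₁']
    refine Measure.AbsolutelyContinuous.prod
      (withDensity_absolutelyContinuous' hρr'_meas.ennreal_ofReal.aemeasurable ?_)
      (withDensity_absolutelyContinuous' hρc'_meas.ennreal_ofReal.aemeasurable ?_)
    · exact hρr'_pos.mono fun x hx => (ENNReal.ofReal_pos.2 hx).ne'
    · exact hρc'_pos.mono fun y hy => (ENNReal.ofReal_pos.2 hy).ne'
  -- Over the primed product, `R` has a cost bounded by ‖κ‖ + M, which yields the intermediate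
  -- potentials.
  obtain ⟨θ, hθ, hθb, hRθ⟩ := exists_cost_change_of_reference (hmμ.trans hμm')
    (hmμ'.ae_le hratio) hκ.aestronglyMeasurable.aemeasurable hκb
  rw [← hR] at hRθ
  -- potentials of the two bridges and of the intermediate one
  obtain ⟨f, g, B, hf, hg, hfB, hgB, hof, hog, hb, hc⟩ :=
    exists_schrodinger_potentials μ₀ μ₁ hκ.aestronglyMeasurable.aemeasurable hN hκb
  obtain ⟨f', g', B', hf', hg', hfB', hgB', hof', hog', hb', hc'⟩ :=
    exists_schrodinger_potentials μ₀' μ₁' hκ'.aestronglyMeasurable.aemeasurable hN' hκb'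
  obtain ⟨fi, gi, Bi, hfi, hgi, hfBi, hgBi, hofi, hogi, hbi, hci⟩ :=
    exists_schrodinger_potentials μ₀' μ₁' hθ (add_nonneg hN hM) hθb
  rw [← hm, ← hR] at hc
  rw [← hm', ← hR'] at hc'
  rw [← hm', ← hRθ] at hci
  set P := R.withDensity fun z => ENNReal.ofReal (Real.exp (f z.1 + g z.2)) with hP
  set P' := R'.withDensity fun z => ENNReal.ofReal (Real.exp (f' z.1 + g' z.2)) with hP'
  set Q := R.withDensity fun z => ENNReal.ofReal (Real.exp (fi z.1 + gi z.2)) with hQ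
  have hbridge := isSchrodingerBridge_iff_eq hf hg hfB hgB hP hc
  have hbridge' := isSchrodingerBridge_iff_eq hf' hg' hfB' hgB' hP' hc'
  refine ⟨⟨P, (hbridge P).2 rfl, fun π h => (hbridge π).1 h⟩,
    ⟨P', (hbridge' P').2 rfl, fun π h => (hbridge' π).1 h⟩, fun π π' hπ hπ' => ?_⟩
  rw [(hbridge π).1 hπ, (hbridge' π').1 hπ']
  have := hc.isProbabilityMeasure
  have := hc'.isProbabilityMeasure
  have := hci.isProbabilityMeasure
  have hφ : Measurable fun z : X × Y => f z.1 + g z.2 :=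
    (hf.comp measurable_fst).add (hg.comp measurable_snd)
  have hφ' : Measurable fun z : X × Y => f' z.1 + g' z.2 :=
    (hf'.comp measurable_fst).add (hg'.comp measurable_snd)
  have hφi : Measurable fun z : X × Y => fi z.1 + gi z.2 :=
    (hfi.comp measurable_fst).add (hgi.comp measurable_snd)
  set N := linftyNorm m κ
  set N' := linftyNorm m' κ'
  -- change of marginals
  have hPQ : hellingerDist P Q ^ 2 ≤ 2 * (N + M) *
      ((∫ x, |ρr x - ρr' x| ∂μ) + ∫ y, |ρc y - ρc' y| ∂ν) := by
    have h := hellingerDist_withDensity_exp_sq_le hφ hφi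
      (fun z => (hb z).trans (show 3 * N ≤ 3 * (N + M) by linarith)) hbi hP hQ
    rw [hellingerDist_self] at h
    have e : ∀ z : X × Y, f z.1 + g z.2 - (fi z.1 + gi z.2) =
        (f - fi) z.1 + (g - gi) z.2 := fun z => by simp only [Pi.sub_apply]; ring
    have hfd : ∀ x, |(f - fi) x| ≤ B + Bi := fun x =>
      (abs_sub _ _).trans (add_le_add (hfB x) (hfBi x))
    have hgd : ∀ y, |(g - gi) y| ≤ B + Bi := fun y =>
      (abs_sub _ _).trans (add_le_add (hgB y) (hgBi y))
    simp_rw [e] at h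
    rw [hc.integral_add (hf.sub hfi) (hg.sub hgi) hfd hgd,
      hci.integral_add (hf.sub hfi) (hg.sub hgi) hfd hgd] at h
    -- The oscillations add up to 2N + 2(N + M) ≤ 4(N + M).
    have h1 := integral_sub_le_of_osc_le hρr_meas hρr'_meas hρr_pos hρr'_pos hμ₀ hμ₀'
      (hf.sub hfi) (C := 4 * (N + M)) fun x x' => by
        have h1 := abs_le.1 (hof x x')
        have h2 := abs_le.1 (hofi x x')
        simp only [Pi.sub_apply]
        exact abs_le.2 ⟨by linarith, by linarith⟩
    have h2 := integral_sub_le_of_osc_le hρc_meas hρc'_meas hρc_pos hρc'_pos hμ₁ hμ₁'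
      (hg.sub hgi) (C := 4 * (N + M)) fun y y' => by
        have h1 := abs_le.1 (hog y y')
        have h2 := abs_le.1 (hogi y y')
        simp only [Pi.sub_apply]
        exact abs_le.2 ⟨by linarith, by linarith⟩
    linarith
  -- change of reference measure
  have hQP : hellingerDist Q P' ^ 2 ≤
      Real.exp (3 * max (N + M) N') * hellingerDist R R' ^ 2 := by
    have h := hellingerDist_withDensity_exp_sq_le hφi hφ'
      (fun z => (hbi z).trans (mul_le_mul_of_nonneg_left (le_max_left (N + M) N') (by norm_num)))
      (fun z => (hb' z).trans (mul_le_mul_of_nonneg_left (le_max_right (N + M) N') (by norm_num)))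
      hQ hP'
    have e : ∀ z : X × Y, fi z.1 + gi z.2 - (f' z.1 + g' z.2) =
        (fi - f') z.1 + (gi - g') z.2 := fun z => by simp only [Pi.sub_apply]; ring
    have hfd : ∀ x, |(fi - f') x| ≤ Bi + B' := fun x =>
      (abs_sub _ _).trans (add_le_add (hfBi x) (hfB' x))
    have hgd : ∀ y, |(gi - g') y| ≤ Bi + B' := fun y =>
      (abs_sub _ _).trans (add_le_add (hgBi y) (hgB' y))
    simp_rw [e] at h
    -- `Q` and `P'` share their marginals, so the two integrals cancel.
    rw [hci.integral_add (hfi.sub hf') (hgi.sub hg') hfd hgd,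
      hc'.integral_add (hfi.sub hf') (hgi.sub hg') hfd hgd, sub_self] at h
    linarith
  have htri := hellingerDist_sq_le_two_mul_add P Q P'
  -- The argument gives constants 4 and 2; nonnegativity of both terms relaxes them to 8 and 4.
  have hD : 0 ≤ (N + M) * ((∫ x, |ρr x - ρr' x| ∂μ) + ∫ y, |ρc y - ρc' y| ∂ν) :=
    mul_nonneg (add_nonneg hN hM) (add_nonneg (integral_nonneg fun _ => abs_nonneg _)
      (integral_nonneg fun _ => abs_nonneg _))
  have hE : 0 ≤ Real.exp (3 * max (N + M) N') * hellingerDist R R' ^ 2 := by positivity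
  linarith
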